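/- Let $T\subset\mathbb{R}^3$ be a 4-ball tetrahedron, i.e. a nondegenerate (closed) tetrahedron for which there is a sphere $S$ (the mid-sphere) touching each of its six edges at a point of that edge, and suppose that the center $G$ of $S$ lies in the interior of $T$. Then $T$ can be partitioned face-to-face into $24$ path tetrahedra, that is: there are $24$ nondegenerate tetrahedra, each having three mutually orthogonal edges that do not intersect at a single point, whose union is $T$ and any two of which meet in a common proper face (a triangle, an edge, a vertex, or the empty set). Moreover, such a partition is obtained as follows. For each face $\Phi$ of $T$, the triangles with vertices $A$, $P$, $F$, where $A$ is a vertex of $\Phi$, $P$ is the point where $S$ touches one of the two edges of $\Phi$ at $A$, and $F$ is the incenter of $\Phi$, are six right triangles forming a face-to-face partition of $\Phi$; the $24$ path tetrahedra are the convex hulls of these triangles (for all four faces) with $G$. -/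

import Mathlib

open EuclideanGeometry
open scoped Affine

/-- Euclidean three-dimensional space. -/
abbrev Space3 : Type := EuclideanSpace ℝ (Fin 3)

/-- The sphere `S` touches the segment with end points `a` and `b` at the point `p`: the point `p`
lies on the segment, and the line through `a` and `b` is tangent to `S` at `p`. -/
def TouchesSegmentAt (S : Sphere Space3) (a b p : Space3) : Prop :=
  p ∈ segment ℝ a b ∧ S.IsTangentAt p line[ℝ, a, b]

/-- `S` is a mid-sphere of the tetrahedron `T`: it is tangent to all six edges of `T`. A tetrahedron
is a 4-ball tetrahedron if it has a mid-sphere. -/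
def IsMidSphere (T : Affine.Simplex ℝ Space3 3) (S : Sphere Space3) : Prop :=
  ∀ i j : Fin 4, i ≠ j → ∃ p, TouchesSegmentAt S (T.points i) (T.points j) p

/-- `t` is the vertex set of a nondegenerate simplex of dimension `n` in space
(a triangle for `n = 2`, a tetrahedron for `n = 3`). -/
def IsVertexSet (n : ℕ) (t : Finset Space3) : Prop :=
  t.card = n + 1 ∧ AffineIndependent ℝ ((↑) : t → Space3)

/-- `a` and `b` are the end points of an edge of the simplex with vertex set `t`. -/
def IsEdge (t : Finset Space3) (a b : Space3) : Prop :=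
  a ∈ t ∧ b ∈ t ∧ a ≠ b

/-- `t` is the vertex set of a path tetrahedron: a tetrahedron with three mutually orthogonal
edges that do not intersect at a single point. -/
def IsPathTetrahedron (t : Finset Space3) : Prop :=
  IsVertexSet 3 t ∧
    ∃ a₁ b₁ a₂ b₂ a₃ b₃ : Space3,
      IsEdge t a₁ b₁ ∧ IsEdge t a₂ b₂ ∧ IsEdge t a₃ b₃ ∧
      inner ℝ (b₁ - a₁) (b₂ - a₂) = 0 ∧
      inner ℝ (b₁ - a₁) (b₃ - a₃) = 0 ∧
      inner ℝ (b₂ - a₂) (b₃ - a₃) = 0 ∧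
      segment ℝ a₁ b₁ ∩ segment ℝ a₂ b₂ ∩ segment ℝ a₃ b₃ = ∅

/-- `q` is the vertex set of a right triangle. -/
def IsRightTriangle (q : Finset Space3) : Prop :=
  IsVertexSet 2 q ∧ ∃ a ∈ q, ∃ b ∈ q, ∃ c ∈ q, ∠ a b c = Real.pi / 2 ∧ a ≠ b ∧ c ≠ b

/-- The simplices of dimension `n` with vertex sets in `K` form a face-to-face partition of `X`:
there are finitely many of them, their union is `X`, and any two different ones meet in a common
proper face (a vertex, an edge, … or the empty set, spanned by a common set `u` of vertices);
in particular their relative interiors are disjoint. -/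
structure IsFaceToFacePartition (n : ℕ) (K : Set (Finset Space3)) (X : Set Space3) : Prop where
  finite : K.Finite
  isVertexSet : ∀ t ∈ K, IsVertexSet n t
  iUnion_eq : ⋃ t ∈ K, convexHull ℝ (t : Set Space3) = X
  inter_eq : ∀ s ∈ K, ∀ t ∈ K, s ≠ t → ∃ u : Finset Space3, u ⊂ s ∧ u ⊂ t ∧
    convexHull ℝ (s : Set Space3) ∩ convexHull ℝ (t : Set Space3) = convexHull ℝ (u : Set Space3)

open scoped Classical in
/-- The triangles into which the face of `T` opposite to the vertex `l` is split: their vertices are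
a vertex of the face, the point where `S` touches an edge of the face at this vertex, and the
incenter of the face. -/
def faceTriangles (T : Affine.Simplex ℝ Space3 3) (S : Sphere Space3) (l : Fin 4) :
    Set (Finset Space3) :=
  {q | ∃ i j : Fin 4, i ≠ j ∧ i ≠ l ∧ j ≠ l ∧ ∃ p,
    TouchesSegmentAt S (T.points i) (T.points j) p ∧
      q = {T.points i, p, (T.faceOpposite l).incenter}}

open scoped Classical in
/-- The tetrahedra that arise when the triangles of all four faces are coned to the center
of `S`. -/
def conedTetrahedra (T : Affine.Simplex ℝ Space3 3) (S : Sphere Space3) :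
    Set (Finset Space3) :=
  {t | ∃ l : Fin 4, ∃ q ∈ faceTriangles T S l, t = insert S.center q}

/-!
Every face of the tetrahedron, of any dimension, carries a distinguished point in its relative
interior: a vertex itself, the point where the mid-sphere touches an edge, the incenter of a
triangular face, and the center `G` of the sphere for the whole tetrahedron. The 24 cells are
spanned by the distinguished points of the maximal flags (vertex, edge, face, tetrahedron), as in
the barycentric subdivision.

That such flags subdivide a simplex is linear algebra in barycentric coordinates, and does not
depend on the choice of the points. Let `b s` be the coordinates of the point of the face `s`. Every
nonnegative vector is a nonnegative combination of the `b s` for the `s` in a flag: subtract the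
largest possible multiple of `b s`, for `s` the whole simplex, which makes a coordinate vanish, and
go on in the face thus reached (`IsFaceWeights.exists_sub_smul`). The combination is unique, even
when the flag is not prescribed (`IsFaceWeights.eq_of_sum_eq`): the support of the vector is the
largest face that occurs, so coefficients can be cancelled from the top. Uniqueness shows that the
points of a flag are affinely independent and that two cells meet in the cell spanned by the common
faces (`IsFaceWeights.convexHull_inter`), which is the face-to-face property.

The geometry enters in two places. The sphere cannot touch an edge at an end point, since it would
then touch all edges at this vertex there and `G` would be the vertex (`IsMidSphere.ne_left`). The
plane of a face cuts the sphere in a circle touching the three sides at inner points; so it is the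
incircle, and the incenter is the foot of the perpendicular from `G`
(`IsMidSphere.inner_incenter`). Hence for a vertex `A`, a tangent point `P`, and an incenter `F`
of a flag, `AP`, `PF` and `FG` are mutually orthogonal.
-/

/-! ### Points in the relative interiors of the faces of a simplex -/

/-- `b s` are barycentric coordinates of a point in the relative interior of the face spanned by
the vertices in `s`, for every nonempty set `s` of vertices of a simplex; `b ∅ = 0`. -/
structure IsFaceWeights {ι : Type*} [Fintype ι] (b : Finset ι → ι → ℝ) : Prop where
  pos : ∀ s, ∀ i ∈ s, 0 < b s i
  zero : ∀ s, ∀ i ∉ s, b s i = 0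
  sum_eq_one : ∀ s : Finset ι, s.Nonempty → ∑ i, b s i = 1

/-- The point with barycentric coordinates `b s` with respect to the vertices `v`. -/
def facePoint {ι E : Type*} [Fintype ι] [AddCommGroup E] [Module ℝ E] (v : ι → E)
    (b : Finset ι → ι → ℝ) (s : Finset ι) : E :=
  ∑ i, b s i • v i

/-- A flag: a set of nonempty faces that is totally ordered by inclusion. -/
def IsFaceChain {ι : Type*} (D : Finset (Finset ι)) : Prop :=
  (∀ s ∈ D, s.Nonempty) ∧ ∀ s ∈ D, ∀ t ∈ D, s ⊆ t ∨ t ⊆ s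

theorem IsFaceChain.mono {ι : Type*} {D D' : Finset (Finset ι)} (h : IsFaceChain D)
    (hD : D' ⊆ D) : IsFaceChain D' :=
  ⟨fun s hs => h.1 s (hD hs), fun s hs t ht => h.2 s (hD hs) t (hD ht)⟩

/-! ### Chains of faces and nonnegative vectors -/

/-- A chain of proper subsets of `U` does not cover `U`. -/
theorem exists_forall_notMem_of_chain {ι : Type*} [Fintype ι] [DecidableEq ι] {U : Finset ι}
    (hU : U.Nonempty) {D : Finset (Finset ι)} (hD : IsFaceChain D) (hsub : ∀ s ∈ D, s ⊂ U) :
    ∃ i ∈ U, ∀ s ∈ D, i ∉ s := by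
  rcases D.eq_empty_or_nonempty with rfl | hne
  · obtain ⟨i, hi⟩ := hU
    exact ⟨i, hi, by simp⟩
  obtain ⟨M, hM, hmax⟩ := D.exists_max_image Finset.card hne
  obtain ⟨i, hi, hiM⟩ := Finset.exists_of_ssubset (hsub M hM)
  refine ⟨i, hi, fun s hs his => hiM ?_⟩
  rcases hD.2 s hs M hM with h | h
  · exact h his
  · rwa [Finset.eq_of_subset_of_card_le h (hmax s hs)]

theorem IsFaceWeights.nonneg {ι : Type*} [Fintype ι] {b : Finset ι → ι → ℝ}
    (hb : IsFaceWeights b) (s : Finset ι) (i : ι) : 0 ≤ b s i := by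
  by_cases h : i ∈ s
  · exact (hb.pos s i h).le
  · exact (hb.zero s i h).ge

/-- A nonnegative vector is in at most one way a nonnegative combination of the weights of
the faces in a chain. -/
theorem IsFaceWeights.eq_of_sum_eq {ι : Type*} [Fintype ι] [DecidableEq ι]
    {b : Finset ι → ι → ℝ} (hb : IsFaceWeights b) {D D' : Finset (Finset ι)}
    (hD : IsFaceChain D) (hD' : IsFaceChain D') {c c' : Finset ι → ℝ}
    (hc : ∀ s, 0 ≤ c s) (hc' : ∀ s, 0 ≤ c' s) (hcD : ∀ s ∉ D, c s = 0)
    (hcD' : ∀ s ∉ D', c' s = 0) (h : ∀ i, ∑ s, c s * b s i = ∑ s, c' s * b s i) :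
    c = c' := by
  -- Induction on the support `U` of the common sum: in both representations `U` is the largest
  -- face with a positive coefficient, and the smaller of its two coefficients can be cancelled.
  obtain ⟨U, hU⟩ : ∃ U : Finset ι, ∀ i, i ∈ U ↔ ∑ s, c s * b s i ≠ 0 :=
    ⟨Finset.univ.filter fun i => ∑ s, c s * b s i ≠ 0, by simp⟩
  induction U using Finset.strongInduction generalizing c c' D D' with
  | H U ih =>
  wlog hle : c U ≤ c' U generalizing c c' D D'
  · exact (this hD' hD hc' hc hcD' hcD (fun i => (h i).symm) (fun i => by rw [hU, h])
      (le_of_not_ge hle)).symm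
  have supp : ∀ {c : Finset ι → ℝ}, (∀ s, 0 ≤ c s) → (∀ i ∉ U, ∑ s, c s * b s i = 0) →
      ∀ s, c s ≠ 0 → s ⊆ U := by
    intro c hc hi s hs i his
    by_contra hiU
    have := (Finset.sum_eq_zero_iff_of_nonneg
      (fun s _ => mul_nonneg (hc s) (hb.nonneg s i))).1 (hi i hiU) s (Finset.mem_univ s)
    exact (mul_pos (lt_of_le_of_ne (hc s) hs.symm) (hb.pos s i his)).ne' this
  have hz : ∀ i ∉ U, ∑ s, c s * b s i = 0 := fun i hi => by
    by_contra hne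
    exact hi ((hU i).2 hne)
  have hs := supp hc hz
  have hs' := supp hc' (fun i hi => by rw [← h, hz i hi])
  rcases U.eq_empty_or_nonempty with rfl | hUne
  · have key : ∀ {D : Finset (Finset ι)} {c : Finset ι → ℝ}, IsFaceChain D →
        (∀ s ∉ D, c s = 0) → (∀ s, c s ≠ 0 → s ⊆ ∅) → ∀ s, c s = 0 := by
      intro D c hD hcD hs s
      by_contra hne
      have h1 := hs s hne
      by_cases hsD : s ∈ D
      · exact (hD.1 s hsD).ne_empty (Finset.subset_empty.1 h1)
      · exact hne (hcD s hsD)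
    funext s
    rw [key hD hcD hs, key hD' hcD' hs']
  let d : Finset ι → ℝ := fun s => if s = U then 0 else c s
  let d' : Finset ι → ℝ := fun s => if s = U then c' U - c U else c' s
  have hsum : ∀ i, ∑ s, d s * b s i = ∑ s, c s * b s i - c U * b U i := by
    intro i
    have : ∀ s, d s * b s i = c s * b s i - if s = U then c U * b U i else 0 := by
      intro s
      by_cases hsU : s = U
      · simp [d, hsU]
      · simp [d, hsU]
    simp [this]
  have hsum' : ∀ i, ∑ s, d' s * b s i = ∑ s, c' s * b s i - c U * b U i := by
    intro i
    have : ∀ s, d' s * b s i = c' s * b s i - if s = U then c U * b U i else 0 := by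
      intro s
      by_cases hsU : s = U
      · simp [d', hsU]; ring
      · simp [d', hsU]
    simp [this]
  have hdd : ∀ i, ∑ s, d s * b s i = ∑ s, d' s * b s i := fun i => by rw [hsum, hsum', h]
  have hd0 : ∀ s, 0 ≤ d s := fun s => by
    by_cases hsU : s = U <;> simp [d, hsU, hc]
  have hd0' : ∀ s, 0 ≤ d' s := fun s => by
    by_cases hsU : s = U <;> simp [d', hsU, hc', hle]
  obtain ⟨i, hiU, hi⟩ := exists_forall_notMem_of_chain hUne
    (hD.mono (Finset.filter_subset (fun s => d s ≠ 0) D)) (fun s hsD => by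
      have h1 : d s ≠ 0 := (Finset.mem_filter.1 hsD).2
      by_cases hsU : s = U
      · simp [d, hsU] at h1
      · simp only [d, hsU, if_false] at h1
        exact lt_of_le_of_ne (hs s h1) hsU)
  have hi0 : ∑ s, d s * b s i = 0 := Finset.sum_eq_zero fun s _ => by
    by_cases hds : d s = 0
    · simp [hds]
    · by_cases hsD : s ∈ D
      · rw [hb.zero s i (hi s (Finset.mem_filter.2 ⟨hsD, hds⟩)), mul_zero]
      · by_cases hsU : s = U <;> simp [d, hsU, hcD _ hsD] at hds
  have hlt : (Finset.univ.filter fun i => ∑ s, d s * b s i ≠ 0) ⊂ U := by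
    rw [Finset.ssubset_iff_of_subset]
    · exact ⟨i, hiU, by simp [hi0]⟩
    · intro j hj
      by_contra hjU
      rw [Finset.mem_filter, hsum, hz j hjU, hb.zero U j hjU] at hj
      simp at hj
  have hcU : c' U = c U := by
    rw [hdd] at hi0
    have h1 := (Finset.sum_eq_zero_iff_of_nonneg
      (fun s _ => mul_nonneg (hd0' s) (hb.nonneg s i))).1 hi0 U (Finset.mem_univ U)
    rcases mul_eq_zero.1 h1 with h2 | h2
    · simpa [d', sub_eq_zero] using h2
    · exact absurd h2 (hb.pos U i hiU).ne'
  have hfin : d = d' := ih _ hlt hD hD' hd0 hd0'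
    (fun s hsD => by by_cases hsU : s = U <;> simp [d, hsU, hcD s hsD])
    (fun s hsD => by
      by_cases hsU : s = U
      · simp [d', hsU, hcU]
      · simp [d', hsU, hcD' s hsD]) hdd (by simp)
  funext s
  by_cases hsU : s = U
  · rw [hsU, hcU]
  · simpa [d, d', hsU] using congrFun hfin s

/-- The weights of the faces in a chain are linearly independent. -/
theorem IsFaceWeights.eq_zero_of_sum_eq_zero {ι : Type*} [Fintype ι] [DecidableEq ι]
    {b : Finset ι → ι → ℝ} (hb : IsFaceWeights b) {D : Finset (Finset ι)}
    (hD : IsFaceChain D) {c : Finset ι → ℝ} (hcD : ∀ s ∉ D, c s = 0)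
    (h : ∀ i, ∑ s, c s * b s i = 0) : c = 0 := by
  have key := hb.eq_of_sum_eq hD hD (c := fun s => max (c s) 0) (c' := fun s => max (-c s) 0)
    (fun s => le_max_right _ _) (fun s => le_max_right _ _) (fun s hs => by simp [hcD s hs])
    (fun s hs => by simp [hcD s hs]) (fun i => by
      rw [← sub_eq_zero, ← Finset.sum_sub_distrib]
      refine (Finset.sum_congr rfl fun s _ => ?_).trans (h i)
      rw [← sub_mul, max_zero_sub_max_neg_zero_eq_self])
  funext s
  have h1 := max_zero_sub_max_neg_zero_eq_self (c s)
  rw [congrFun key s, sub_self] at h1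
  exact h1.symm

/-- From a nonnegative vector supported in `s`, a multiple of the weights of `s` can be subtracted
so that a further coordinate vanishes and the vector stays nonnegative. -/
theorem IsFaceWeights.exists_sub_smul {ι : Type*} [Fintype ι] [DecidableEq ι]
    {b : Finset ι → ι → ℝ} (hb : IsFaceWeights b) {s : Finset ι} (hs : s.Nonempty) {x : ι → ℝ}
    (hx : ∀ i, 0 ≤ x i) (hxs : ∀ i ∉ s, x i = 0) :
    ∃ t : ℝ, 0 ≤ t ∧ ∃ l ∈ s, (∀ i, 0 ≤ x i - t * b s i) ∧
      ∀ i ∉ s.erase l, x i - t * b s i = 0 := by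
  obtain ⟨l, hl, hmin⟩ := s.exists_min_image (fun i => x i / b s i) hs
  have hbl := hb.pos s l hl
  refine ⟨x l / b s l, div_nonneg (hx l) hbl.le, l, hl, fun i => ?_, fun i hi => ?_⟩
  · by_cases his : i ∈ s
    · have := hmin i his
      rw [le_div_iff₀ (hb.pos s i his)] at this
      linarith
    · simp [hb.zero s i his, hx i]
  · by_cases his : i ∈ s
    · have hil : i = l := by
        by_contra hne
        exact hi (Finset.mem_erase.2 ⟨hne, his⟩)
      subst hil
      field_simp
      ring
    · simp [hb.zero s i his, hxs i his]

/-! ### Simplices spanned by chains of face points -/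

theorem AffineIndependent.eq_of_sum_smul_eq {ι E : Type*} [Fintype ι] [AddCommGroup E]
    [Module ℝ E] {v : ι → E} (hv : AffineIndependent ℝ v) {w w' : ι → ℝ}
    (hw : ∑ i, w i = ∑ i, w' i) (h : ∑ i, w i • v i = ∑ i, w' i • v i) : w = w' := by
  funext i
  have := affineIndependent_iff.1 hv Finset.univ (fun i => w i - w' i)
    (by rw [Finset.sum_sub_distrib, hw, sub_self])
    (by simp_rw [sub_smul]; rw [Finset.sum_sub_distrib, h, sub_self]) i (Finset.mem_univ i)
  exact sub_eq_zero.1 this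

theorem IsFaceWeights.facePoint_inj {ι E : Type*} [Fintype ι] [AddCommGroup E]
    [Module ℝ E] {v : ι → E} (hv : AffineIndependent ℝ v) {b : Finset ι → ι → ℝ}
    (hb : IsFaceWeights b) {s t : Finset ι} (hs : s.Nonempty) (ht : t.Nonempty)
    (h : facePoint v b s = facePoint v b t) : s = t := by
  have hst : b s = b t := hv.eq_of_sum_smul_eq
    (by rw [hb.sum_eq_one s hs, hb.sum_eq_one t ht]) h
  ext i
  constructor
  · intro hi
    by_contra hit
    have := hb.pos s i hi
    rw [hst, hb.zero t i hit] at this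
    exact lt_irrefl _ this
  · intro hi
    by_contra his
    have := hb.pos t i hi
    rw [← hst, hb.zero s i his] at this
    exact lt_irrefl _ this

theorem sum_smul_facePoint {ι E : Type*} [Fintype ι] [AddCommGroup E]
    [Module ℝ E] (v : ι → E) (b : Finset ι → ι → ℝ) (c : Finset ι → ℝ) :
    ∑ s, c s • facePoint v b s = ∑ i, (∑ s, c s * b s i) • v i := by
  simp_rw [facePoint, Finset.smul_sum, Finset.sum_smul, smul_smul]
  exact Finset.sum_comm

theorem IsFaceWeights.sum_sum {ι : Type*} [Fintype ι] [DecidableEq ι] {b : Finset ι → ι → ℝ}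
    (hb : IsFaceWeights b) {D : Finset (Finset ι)} (hD : IsFaceChain D) {c : Finset ι → ℝ}
    (hcD : ∀ s ∉ D, c s = 0) : ∑ i, ∑ s, c s * b s i = ∑ s, c s := by
  rw [Finset.sum_comm]
  refine Finset.sum_congr rfl fun s _ => ?_
  rw [← Finset.mul_sum]
  by_cases hs : s ∈ D
  · rw [hb.sum_eq_one s (hD.1 s hs), mul_one]
  · rw [hcD s hs, zero_mul]

theorem IsFaceWeights.mem_convexHull_image_iff {ι E : Type*} [Fintype ι] [DecidableEq ι]
    [DecidableEq E] [AddCommGroup E] [Module ℝ E] {v : ι → E} (hv : AffineIndependent ℝ v)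
    {b : Finset ι → ι → ℝ} (hb : IsFaceWeights b) {D : Finset (Finset ι)}
    (hD : IsFaceChain D) {x : E} :
    x ∈ convexHull ℝ (D.image (facePoint v b) : Set E) ↔ ∃ c : Finset ι → ℝ,
      (∀ s, 0 ≤ c s) ∧ (∀ s ∉ D, c s = 0) ∧ ∑ s, c s = 1 ∧ ∑ s, c s • facePoint v b s = x := by
  have hinj : Set.InjOn (facePoint v b) D := fun s hs t ht h =>
    hb.facePoint_inj hv (hD.1 s hs) (hD.1 t ht) h
  rw [Finset.mem_convexHull']
  constructor
  · rintro ⟨w, hw0, hw1, hwx⟩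
    rw [Finset.sum_image hinj] at hw1 hwx
    refine ⟨fun s => if s ∈ D then w (facePoint v b s) else 0, fun s => ?_,
      fun s hs => by simp [hs], ?_, ?_⟩
    · by_cases hs : s ∈ D
      · simpa [hs] using hw0 _ (Finset.mem_image_of_mem _ hs)
      · simp [hs]
    · rw [← hw1]
      simp
    · rw [← hwx]
      simp [ite_smul]
  · rintro ⟨c, hc0, hcD, hc1, hcx⟩
    rw [← Finset.mem_convexHull', ← hcx]
    have h1 : ∑ s, c s • facePoint v b s = ∑ s ∈ D, c s • facePoint v b s :=
      (Finset.sum_subset (Finset.subset_univ D) fun s _ hs => by simp [hcD s hs]).symm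
    have h2 : ∑ s ∈ D, c s = 1 := by
      rw [← hc1]
      exact Finset.sum_subset (Finset.subset_univ D) fun s _ hs => by simp [hcD s hs]
    rw [h1]
    exact (convex_convexHull ℝ _).sum_mem (fun s _ => hc0 s) h2 fun s hs =>
      subset_convexHull ℝ _ (Finset.mem_coe.2 (Finset.mem_image_of_mem _ hs))

/-- Simplices spanned by two chains meet in the simplex spanned by the common faces. -/
theorem IsFaceWeights.convexHull_inter {ι E : Type*} [Fintype ι] [DecidableEq ι]
    [DecidableEq E] [AddCommGroup E] [Module ℝ E] {v : ι → E} (hv : AffineIndependent ℝ v)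
    {b : Finset ι → ι → ℝ} (hb : IsFaceWeights b) {D D' : Finset (Finset ι)}
    (hD : IsFaceChain D) (hD' : IsFaceChain D') :
    convexHull ℝ (D.image (facePoint v b) : Set E) ∩
      convexHull ℝ (D'.image (facePoint v b) : Set E) =
      convexHull ℝ ((D ∩ D').image (facePoint v b) : Set E) := by
  apply Set.Subset.antisymm
  · rintro x ⟨hx, hx'⟩
    obtain ⟨c, hc0, hcD, hc1, hcx⟩ := (hb.mem_convexHull_image_iff hv hD).1 hx
    obtain ⟨c', hc0', hcD', hc1', hcx'⟩ := (hb.mem_convexHull_image_iff hv hD').1 hx'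
    have hcc : c = c' := by
      refine hb.eq_of_sum_eq hD hD' hc0 hc0' hcD hcD' (congrFun ?_)
      refine hv.eq_of_sum_smul_eq ?_ ?_
      · rw [hb.sum_sum hD hcD, hb.sum_sum hD' hcD', hc1, hc1']
      · rw [← sum_smul_facePoint, ← sum_smul_facePoint, hcx, hcx']
    refine (hb.mem_convexHull_image_iff hv (hD.mono Finset.inter_subset_left)).2
      ⟨c, hc0, fun s hs => ?_, hc1, hcx⟩
    by_cases h : s ∈ D
    · rw [hcc]
      exact hcD' s fun h' => hs (Finset.mem_inter.2 ⟨h, h'⟩)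
    · exact hcD s h
  · exact Set.subset_inter
      (convexHull_mono (Finset.coe_subset.2 (Finset.image_subset_image Finset.inter_subset_left)))
      (convexHull_mono (Finset.coe_subset.2 (Finset.image_subset_image Finset.inter_subset_right)))

open scoped Classical in
theorem IsFaceWeights.isVertexSet {ι : Type*} [Fintype ι] {v : ι → Space3}
    (hv : AffineIndependent ℝ v) {b : Finset ι → ι → ℝ} (hb : IsFaceWeights b)
    {D : Finset (Finset ι)} (hD : IsFaceChain D) {n : ℕ} (hn : D.card = n + 1) :
    IsVertexSet n (D.image (facePoint v b)) := by
  have hinj : Set.InjOn (facePoint v b) D := fun s hs t ht h =>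
    hb.facePoint_inj hv (hD.1 s hs) (hD.1 t ht) h
  refine ⟨by rw [Finset.card_image_of_injOn hinj, hn], ?_⟩
  have hai : AffineIndependent ℝ (fun s : D => facePoint v b s) := by
    rw [affineIndependent_iff]
    intro A w hw0 hwx
    let c : Finset ι → ℝ := fun s => if h : s ∈ D then (if ⟨s, h⟩ ∈ A then w ⟨s, h⟩ else 0) else 0
    have hcD : ∀ s ∉ D, c s = 0 := fun s hs => by simp [c, hs]
    have hc : ∀ s : D, c s = if s ∈ A then w s else 0 := fun s => by simp [c]
    have hc1 : ∑ s, c s = 0 := by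
      rw [← hw0, ← Finset.sum_subset (Finset.subset_univ D) fun s _ hs => hcD s hs,
        ← Finset.sum_coe_sort]
      simp [hc, -Finset.univ_eq_attach]
    have hcx : ∑ s, c s • facePoint v b s = 0 := by
      rw [← hwx, ← Finset.sum_subset (Finset.subset_univ D) fun s _ hs => by simp [hcD s hs],
        ← Finset.sum_coe_sort]
      simp [hc, ite_smul, -Finset.univ_eq_attach]
    have h0 : c = 0 := by
      refine hb.eq_zero_of_sum_eq_zero hD hcD (congrFun (?_ : _ = (0 : ι → ℝ)))
      refine hv.eq_of_sum_smul_eq ?_ ?_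
      · rw [hb.sum_sum hD hcD, hc1]
        simp
      · rw [← sum_smul_facePoint, hcx]
        simp
    intro s hs
    have := hc s
    rw [h0, if_pos hs] at this
    exact this.symm
  have := hai.range
  have hr : Set.range (fun s : D => facePoint v b s) =
      ((D.image (facePoint v b) : Finset Space3) : Set Space3) := by
    ext x
    simp
  rw [hr] at this
  exact this

open scoped Classical in
/-- A family of chains of the same size whose simplices cover `X` yields a face-to-face
partition of `X`. -/
theorem IsFaceWeights.isFaceToFacePartition {ι : Type*} [Fintype ι] {v : ι → Space3}
    (hv : AffineIndependent ℝ v) {b : Finset ι → ι → ℝ} (hb : IsFaceWeights b)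
    {F : Set (Finset (Finset ι))} (hF : ∀ D ∈ F, IsFaceChain D) {n : ℕ}
    (hn : ∀ D ∈ F, D.card = n + 1) {X : Set Space3}
    (hX : ∀ x, x ∈ X ↔ ∃ D ∈ F, x ∈ convexHull ℝ (D.image (facePoint v b) : Set Space3)) :
    IsFaceToFacePartition n ((fun D => D.image (facePoint v b)) '' F) X where
  finite := F.toFinite.image _
  isVertexSet := by
    rintro _ ⟨D, hD, rfl⟩
    exact hb.isVertexSet hv (hF D hD) (hn D hD)
  iUnion_eq := by
    ext x
    simp [hX]
  inter_eq := by
    rintro _ ⟨D, hD, rfl⟩ _ ⟨D', hD', rfl⟩ hne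
    refine ⟨(D ∩ D').image (facePoint v b), ?_, ?_, hb.convexHull_inter hv (hF D hD) (hF D' hD')⟩
    all_goals
      refine lt_of_le_of_ne (Finset.image_subset_image (by simp)) fun h => hne ?_
      have hinj : Set.InjOn (facePoint v b) {s : Finset ι | s.Nonempty} :=
        fun s hs t ht h => hb.facePoint_inj hv hs ht h
      have h2 := Finset.card_le_card h.ge
      rw [Finset.card_image_of_injOn (hinj.mono (hF _ ‹_›).1),
        Finset.card_image_of_injOn (hinj.mono fun s hs =>
          (hF D hD).1 s (Finset.mem_inter.1 hs).1)] at h2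
    · have e1 := Finset.eq_of_subset_of_card_le Finset.inter_subset_left h2
      have e2 := Finset.eq_of_subset_of_card_le (e1 ▸ Finset.inter_subset_right : D ⊆ D')
        (by rw [hn D hD, hn D' hD'])
      rw [e2]
    · have e1 := Finset.eq_of_subset_of_card_le Finset.inter_subset_right h2
      have e2 := Finset.eq_of_subset_of_card_le (e1 ▸ Finset.inter_subset_left : D' ⊆ D)
        (by rw [hn D hD, hn D' hD'])
      rw [e2]

/-! ### The tangent points and the incenters -/

theorem TouchesSegmentAt.symm {S : Sphere Space3} {a b p : Space3}
    (h : TouchesSegmentAt S a b p) : TouchesSegmentAt S b a p := by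
  refine ⟨segment_symm ℝ a b ▸ h.1, ?_⟩
  rw [Set.pair_comm]
  exact h.2

theorem TouchesSegmentAt.eq {S : Sphere Space3} {a b p q : Space3}
    (hp : TouchesSegmentAt S a b p) (hq : TouchesSegmentAt S a b q) : p = q :=
  hp.2.eq_of_isTangentAt hq.2

theorem TouchesSegmentAt.inner_left {S : Sphere Space3} {a b p : Space3}
    (h : TouchesSegmentAt S a b p) : inner ℝ (p - S.center) (a - p) = 0 :=
  h.2.inner_right_eq_zero_of_mem (left_mem_affineSpan_pair ℝ a b)

theorem TouchesSegmentAt.inner_right {S : Sphere Space3} {a b p : Space3}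
    (h : TouchesSegmentAt S a b p) : inner ℝ (p - S.center) (b - p) = 0 :=
  h.2.inner_right_eq_zero_of_mem (right_mem_affineSpan_pair ℝ a b)

theorem exists_weights_of_mem_interior {n : ℕ} (T : Affine.Simplex ℝ Space3 n) {x : Space3}
    (hx : x ∈ T.interior) :
    ∃ w : Fin (n + 1) → ℝ, (∀ i, 0 < w i) ∧ ∑ i, w i = 1 ∧ ∑ i, w i • T.points i = x := by
  obtain ⟨w, hw1, hw, rfl⟩ := hx
  refine ⟨w, fun i => (hw i).1, hw1, ?_⟩
  rw [Finset.affineCombination_eq_linear_combination _ _ _ hw1]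

theorem mem_closedInterior_iff_exists_weights {n : ℕ} (T : Affine.Simplex ℝ Space3 n)
    {x : Space3} : x ∈ T.closedInterior ↔
    ∃ w : Fin (n + 1) → ℝ, (∀ i, 0 ≤ w i) ∧ ∑ i, w i = 1 ∧ ∑ i, w i • T.points i = x := by
  constructor
  · rintro ⟨w, hw1, hw, rfl⟩
    exact ⟨w, fun i => (hw i).1, hw1,
      (Finset.affineCombination_eq_linear_combination _ _ _ hw1).symm⟩
  · rintro ⟨w, hw, hw1, rfl⟩
    rw [← Finset.affineCombination_eq_linear_combination _ _ _ hw1,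
      Affine.Simplex.affineCombination_mem_closedInterior_iff hw1]
    exact fun i => ⟨hw i, hw1 ▸ Finset.single_le_sum (fun j _ => hw j) (Finset.mem_univ i)⟩

/-- The mid-sphere does not pass through a vertex: otherwise it would touch all edges at this
vertex there, and its center could only be the vertex itself. -/
theorem IsMidSphere.ne_left {T : Affine.Simplex ℝ Space3 3} {S : Sphere Space3}
    (hS : IsMidSphere T S) (hcenter : S.center ∈ T.interior) {i j : Fin 4} {p : Space3}
    (hp : TouchesSegmentAt S (T.points i) (T.points j) p) : p ≠ T.points i := by
  rintro rfl
  obtain ⟨w, -, hw1, hw⟩ := exists_weights_of_mem_interior T hcenter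
  have horth : ∀ k, inner ℝ (T.points i - S.center) (T.points k - T.points i) = 0 := by
    intro k
    rcases eq_or_ne i k with rfl | hik
    · simp
    obtain ⟨q, hq⟩ := hS i k hik
    have hd := hq.2.dist_sq_eq_of_mem (left_mem_affineSpan_pair ℝ _ _)
    rw [EuclideanGeometry.mem_sphere.1 hp.2.mem_sphere] at hd
    have hqi : T.points i = q := by
      rw [← dist_eq_zero]
      nlinarith
    rw [← hqi] at hq
    exact hq.inner_right
  have hsum : S.center - T.points i = ∑ k, w k • (T.points k - T.points i) := by
    simp_rw [smul_sub]
    rw [Finset.sum_sub_distrib, hw, ← Finset.sum_smul, hw1, one_smul]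
  have h0 : inner ℝ (T.points i - S.center) (S.center - T.points i) = 0 := by
    rw [hsum, inner_sum]
    simp [inner_smul_right, horth]
  rw [← neg_sub S.center, inner_neg_left, neg_eq_zero, inner_self_eq_zero, sub_eq_zero] at h0
  exact T.point_notMem_interior i (h0 ▸ hcenter)

theorem IsMidSphere.exists_weights {T : Affine.Simplex ℝ Space3 3} {S : Sphere Space3}
    (hS : IsMidSphere T S) (hcenter : S.center ∈ T.interior) {i j : Fin 4} {p : Space3}
    (hp : TouchesSegmentAt S (T.points i) (T.points j) p) :
    ∃ r s : ℝ, 0 < r ∧ 0 < s ∧ r + s = 1 ∧ r • T.points i + s • T.points j = p := by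
  obtain ⟨r, s, hr, hs, hrs, h⟩ := hp.1
  refine ⟨r, s, lt_of_le_of_ne hr ?_, lt_of_le_of_ne hs ?_, hrs, h⟩
  · rintro rfl
    refine hS.ne_left hcenter hp.symm ?_
    rw [← h, zero_smul, zero_add, ← one_smul ℝ (T.points j), show s = 1 by linarith, smul_smul,
      one_mul]
  · rintro rfl
    refine hS.ne_left hcenter hp ?_
    rw [← h, zero_smul, add_zero, ← one_smul ℝ (T.points i), show r = 1 by linarith, smul_smul,
      one_mul]

/-- A circle in the plane of a triangle that touches the three sides at points of these sides is
the incircle: the excircles touch two of the side lines outside the sides. -/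
theorem eq_incenter_of_isTangentAt (t : Affine.Triangle ℝ Space3) {O : Sphere Space3}
    (hO : O.center ∈ affineSpan ℝ (Set.range t.points))
    (h : ∀ i j, i ≠ j → ∃ p, TouchesSegmentAt O (t.points i) (t.points j) p) :
    O.center = t.incenter := by
  have hline : ∀ i j k : Fin 3, i ≠ j → i ≠ k → j ≠ k →
      line[ℝ, t.points j, t.points k] = affineSpan ℝ (Set.range (t.faceOpposite i).points) := by
    intro i j k hij hik hjk
    have hc : ({i}ᶜ : Set (Fin 3)) = {j, k} := by
      ext x
      simp only [Set.mem_compl_iff, Set.mem_singleton_iff, Set.mem_insert_iff]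
      omega
    rw [Affine.Simplex.range_faceOpposite_points, hc, Set.image_pair]
  have hdist : ∀ i, dist O.center ((t.faceOpposite i).orthogonalProjectionSpan O.center) =
      O.radius := by
    intro i
    obtain ⟨j, k, hij, hik, hjk⟩ : ∃ j k : Fin 3, i ≠ j ∧ i ≠ k ∧ j ≠ k := by
      decide +revert
    obtain ⟨p, hp⟩ := h j k hjk
    have htan := hp.2
    rw [hline i j k hij hik hjk] at htan
    rw [Affine.Simplex.orthogonalProjectionSpan, ← htan.eq_orthogonalProjection, dist_comm]
    exact htan.mem_sphere
  obtain ⟨signs, -, hs⟩ :=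
    (t.exists_forall_dist_eq_iff_exists_excenterExists_and_eq_excenter hO).1 ⟨O.radius, hdist⟩
  rcases Affine.Triangle.excenter_eq_incenter_or_excenter_singleton t signs with hi | ⟨i, hi⟩
  · rw [hs, hi]
  exfalso
  obtain ⟨j, k, hij, hik, hjk⟩ : ∃ j k : Fin 3, i ≠ j ∧ i ≠ k ∧ j ≠ k := by
    clear hi
    decide +revert
  obtain ⟨p, hp⟩ := h k i hik.symm
  have htan := hp.2
  rw [hline j k i hjk hij.symm hik.symm] at htan
  have hpt : p = t.touchpoint {i} j := by
    rw [htan.eq_orthogonalProjection, Affine.Simplex.touchpoint, hs, hi]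
    rfl
  have hout := Affine.Triangle.touchpoint_singleton_sbtw t hij hik hjk
  have hin : Wbtw ℝ (t.points k) p (t.points i) := mem_segment_iff_wbtw.1 hp.1
  rw [← hpt] at hout
  exact hout.not_swap_left hin

theorem faceOpposite_points (T : Affine.Simplex ℝ Space3 3) (l : Fin 4) (i : Fin 3) :
    (T.faceOpposite l).points i = T.points (l.succAbove i) :=
  T.faceOpposite_point_eq_point_succAbove l i

/-- The incenter of a face is the foot of the perpendicular from the center of the mid-sphere. -/
theorem IsMidSphere.inner_incenter {T : Affine.Simplex ℝ Space3 3} {S : Sphere Space3}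
    (hS : IsMidSphere T S) (l : Fin 4) {x y : Space3}
    (hx : x ∈ affineSpan ℝ (Set.range (T.faceOpposite l).points))
    (hy : y ∈ affineSpan ℝ (Set.range (T.faceOpposite l).points)) :
    inner ℝ ((T.faceOpposite l).incenter - S.center) (x - y) = 0 := by
  obtain ⟨f, hfA, horth⟩ : ∃ f ∈ affineSpan ℝ (Set.range (T.faceOpposite l).points),
      ∀ x ∈ affineSpan ℝ (Set.range (T.faceOpposite l).points),
      ∀ y ∈ affineSpan ℝ (Set.range (T.faceOpposite l).points),
        inner ℝ (f - S.center) (x - y) = 0 := by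
    refine ⟨Subtype.val ((T.faceOpposite l).orthogonalProjectionSpan S.center),
      orthogonalProjection_mem _, fun x hx y hy => ?_⟩
    rw [real_inner_comm]
    exact orthogonalProjection_vsub_mem_direction_orthogonal _ S.center _
      (AffineSubspace.vsub_mem_direction hx hy)
  set A := affineSpan ℝ (Set.range (T.faceOpposite l).points) with hA
  -- The plane of the face cuts the sphere in a circle with center `f` that touches the sides at
  -- the points where the sphere does.
  have hrad : ∀ p ∈ A, p ∈ S → dist p f = Real.sqrt (S.radius ^ 2 - dist f S.center ^ 2) := by
    intro p hpA hpS
    have h1 : ‖p - S.center‖ ^ 2 = ‖p - f‖ ^ 2 + ‖f - S.center‖ ^ 2 := by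
      have : p - S.center = (p - f) + (f - S.center) := by abel
      rw [this, sq, sq, sq, norm_add_sq_eq_norm_sq_add_norm_sq_real]
      rw [real_inner_comm]
      exact horth p hpA f hfA
    rw [← dist_eq_norm, ← dist_eq_norm, ← dist_eq_norm,
      EuclideanGeometry.mem_sphere.1 hpS] at h1
    rw [h1, add_sub_cancel_right, Real.sqrt_sq dist_nonneg]
  have hinc : f = (T.faceOpposite l).incenter := by
    refine eq_incenter_of_isTangentAt (T.faceOpposite l)
      (O := ⟨f, Real.sqrt (S.radius ^ 2 - dist f S.center ^ 2)⟩) hfA fun i j hij => ?_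
    have hne : (l.succAbove i : Fin 4) ≠ l.succAbove j :=
      fun h => hij (Fin.succAbove_right_injective h)
    obtain ⟨p, hp⟩ := hS _ _ hne
    rw [← faceOpposite_points, ← faceOpposite_points] at hp
    have hiA : (T.faceOpposite l).points i ∈ A := subset_affineSpan ℝ _ (Set.mem_range_self i)
    have hjA : (T.faceOpposite l).points j ∈ A := subset_affineSpan ℝ _ (Set.mem_range_self j)
    have hle : line[ℝ, (T.faceOpposite l).points i, (T.faceOpposite l).points j] ≤ A :=
      affineSpan_pair_le_of_mem_of_mem hiA hjA
    have hpA := hle hp.2.mem_space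
    refine ⟨p, hp.1, ?_, hp.2.mem_space, fun x hx => ?_⟩
    · exact hrad p hpA hp.2.mem_sphere
    · rw [EuclideanGeometry.Sphere.mem_orthRadius_iff_inner_right]
      have h1 := hp.2.inner_right_eq_zero_of_mem hx
      have h2 := horth x (hle hx) p hpA
      rw [vsub_eq_sub, vsub_eq_sub] at h1 ⊢
      have h3 : p - f = (p - S.center) - (f - S.center) := by abel
      rw [h3, inner_sub_left, h1, h2, sub_zero]
  rw [← hinc]
  exact horth x hx y hy

theorem card_compl_singleton_fin_four (l : Fin 4) : ({l}ᶜ : Finset (Fin 4)).card = 3 := by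
  rw [Finset.card_compl]
  simp

/-- The vertices, the tangent points of the edges, the incenters of the faces and the center of
the mid-sphere lie in the relative interiors of the faces of the tetrahedron. -/
theorem IsMidSphere.exists_isFaceWeights {T : Affine.Simplex ℝ Space3 3} {S : Sphere Space3}
    (hS : IsMidSphere T S) (hcenter : S.center ∈ T.interior) :
    ∃ b : Finset (Fin 4) → Fin 4 → ℝ, IsFaceWeights b ∧
      (∀ i, facePoint T.points b {i} = T.points i) ∧
      (∀ i j, i ≠ j → TouchesSegmentAt S (T.points i) (T.points j) (facePoint T.points b {i, j})) ∧
      (∀ l, facePoint T.points b {l}ᶜ = (T.faceOpposite l).incenter) ∧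
      facePoint T.points b Finset.univ = S.center := by
  have key : ∀ s : Finset (Fin 4), ∃ w : Fin 4 → ℝ, (∀ i ∈ s, 0 < w i) ∧ (∀ i ∉ s, w i = 0) ∧
      (s.Nonempty → ∑ i, w i = 1) ∧ (∀ i, s = {i} → ∑ i, w i • T.points i = T.points i) ∧
      (∀ i j, i ≠ j → s = {i, j} →
        TouchesSegmentAt S (T.points i) (T.points j) (∑ i, w i • T.points i)) ∧
      (∀ l, s = {l}ᶜ → ∑ i, w i • T.points i = (T.faceOpposite l).incenter) ∧
      (s = Finset.univ → ∑ i, w i • T.points i = S.center) := by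
    intro s
    -- The sizes of the five kinds of faces differ, so only one clause below is not vacuous for `s`.
    have hcases : s = ∅ ∨ (∃ i, s = {i}) ∨ (∃ i j, i ≠ j ∧ s = {i, j}) ∨ (∃ l, s = {l}ᶜ) ∨
        s = Finset.univ := by
      clear hcenter hS
      decide +revert
    have c2 : ∀ {i j : Fin 4}, i ≠ j → ({i, j} : Finset (Fin 4)).card = 2 :=
      fun h => Finset.card_pair h
    have c3 := card_compl_singleton_fin_four
    rcases hcases with rfl | ⟨i, rfl⟩ | ⟨i, j, hij, rfl⟩ | ⟨l, rfl⟩ | rfl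
    · refine ⟨0, by simp, by simp, by simp, fun i h => ?_, fun i j hij h => ?_, fun l h => ?_,
        fun h => ?_⟩
      all_goals exfalso; have := congrArg Finset.card h
      · simp at this
      · simp [c2 hij] at this
      · simp [c3] at this
      · simp at this
    · refine ⟨Pi.single i 1, by simp, fun k hk => Pi.single_eq_of_ne (by simpa using hk) _,
        by simp, fun k h => ?_,
        fun k j hkj h => ?_, fun l h => ?_, fun h => ?_⟩
      · rw [Finset.singleton_inj.1 h]
        simp [Pi.single_apply, ite_smul]
      all_goals exfalso; have := congrArg Finset.card h
      · simp [c2 hkj] at this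
      · simp [c3] at this
      · simp at this
    · obtain ⟨p, hp⟩ := hS i j hij
      obtain ⟨r, t, hr, ht, hrt, hp'⟩ := hS.exists_weights hcenter hp
      have hsum : ∑ k, (Pi.single i r + Pi.single j t : Fin 4 → ℝ) k • T.points k = p := by
        simp [add_smul, Finset.sum_add_distrib, Pi.single_apply, ite_smul, hp']
      refine ⟨Pi.single i r + Pi.single j t, fun k hk => ?_, fun k hk => ?_, fun _ => ?_,
        fun k h => ?_, fun k m hkm h => ?_, fun l h => ?_, fun h => ?_⟩
      · rcases Finset.mem_insert.1 hk with rfl | hk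
        · simpa [Pi.single_apply, hij] using hr
        · rw [Finset.mem_singleton.1 hk]
          simpa [Pi.single_apply, hij.symm] using ht
      · simp only [Finset.mem_insert, Finset.mem_singleton, not_or] at hk
        simp [hk.1, hk.2]
      · simp [Finset.sum_add_distrib, hrt]
      · exfalso
        have := congrArg Finset.card h
        simp [c2 hij] at this
      · rw [hsum]
        have hk : k = i ∨ k = j := by
          have : k ∈ ({i, j} : Finset (Fin 4)) := by simp [h]
          simpa using this
        have hm : m = i ∨ m = j := by
          have : m ∈ ({i, j} : Finset (Fin 4)) := by simp [h]
          simpa using this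
        rcases hk with rfl | rfl <;> rcases hm with rfl | rfl
        · exact absurd rfl hkm
        · exact hp
        · exact hp.symm
        · exact absurd rfl hkm
      all_goals exfalso; have := congrArg Finset.card h
      · simp [c2 hij, c3] at this
      · simp [c2 hij] at this
    · obtain ⟨w, hw0, hw1, hw⟩ :=
        exists_weights_of_mem_interior _ (T.faceOpposite l).incenter_mem_interior
      have hs : ∀ k : Fin 3, (l.insertNth (0 : ℝ) w : Fin 4 → ℝ) (l.succAbove k) = w k :=
        fun k => Fin.insertNth_apply_succAbove (α := fun _ => ℝ) l 0 w k
      have hl : (l.insertNth (0 : ℝ) w : Fin 4 → ℝ) l = 0 :=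
        Fin.insertNth_apply_same (α := fun _ => ℝ) l 0 w
      refine ⟨(l.insertNth (0 : ℝ) w : Fin 4 → ℝ), fun k hk => ?_, fun k hk => ?_, fun _ => ?_,
        fun k h => ?_, fun k m hkm h => ?_, fun m h => ?_, fun h => ?_⟩
      · obtain ⟨m, rfl⟩ := Fin.exists_succAbove_eq (show k ≠ l by simpa using hk)
        rw [hs]
        exact hw0 m
      · have : k = l := by simpa using hk
        rw [this, hl]
      · rw [Fin.sum_univ_succAbove _ l, hl, zero_add, ← hw1]
        exact Finset.sum_congr rfl fun k _ => hs k
      · exfalso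
        have := congrArg Finset.card h
        simp [c3] at this
      · exfalso
        have := congrArg Finset.card h
        simp [c2 hkm, c3] at this
      · have hlm : l = m := by simpa using h
        subst hlm
        rw [Fin.sum_univ_succAbove _ l, hl, zero_smul, zero_add, ← hw]
        refine Finset.sum_congr rfl fun k _ => ?_
        rw [hs, faceOpposite_points]
      · exfalso
        have := congrArg Finset.card h
        simp [c3] at this
    · obtain ⟨w, hw0, hw1, hw⟩ := exists_weights_of_mem_interior T hcenter
      refine ⟨w, fun i _ => hw0 i, by simp, fun _ => hw1, fun i h => ?_, fun i j hij h => ?_,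
        fun l h => ?_, fun _ => hw⟩
      all_goals exfalso; have := congrArg Finset.card h
      · simp at this
      · simp [c2 hij] at this
      · simp [c3] at this
  choose b h1 h2 h3 h4 h5 h6 h7 using key
  exact ⟨b, ⟨h1, h2, h3⟩, fun i => h4 _ i rfl, fun i j hij => h5 _ i j hij rfl,
    fun l => h6 _ l rfl, h7 _ rfl⟩

/-! ### Flags of a tetrahedron -/

/-- The flag of a vertex `i`, the edge from `i` to `j` and the face opposite to `l`. -/
def faceFlag (l i j : Fin 4) : Finset (Finset (Fin 4)) :=
  {{i}, {i, j}, {l}ᶜ}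

/-- The maximal flag of the vertex `i`, the edge from `i` to `j`, the face opposite to `l`, and
the tetrahedron. -/
def fullFlag (l i j : Fin 4) : Finset (Finset (Fin 4)) :=
  insert Finset.univ (faceFlag l i j)

/-- The indices of the flags of the face opposite to `l`. -/
def facePairs (l : Fin 4) : Finset (Fin 4 × Fin 4) :=
  Finset.univ.filter fun p => p.1 ≠ p.2 ∧ p.1 ≠ l ∧ p.2 ≠ l

/-- The indices of the maximal flags of a tetrahedron. -/
def flagTriples : Finset (Fin 4 × Fin 4 × Fin 4) :=
  Finset.univ.filter fun p => p.2.1 ≠ p.2.2 ∧ p.2.1 ≠ p.1 ∧ p.2.2 ≠ p.1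

theorem mem_facePairs {l i j : Fin 4} : (i, j) ∈ facePairs l ↔ i ≠ j ∧ i ≠ l ∧ j ≠ l := by
  simp [facePairs]

theorem mem_flagTriples {l i j : Fin 4} : (l, i, j) ∈ flagTriples ↔ i ≠ j ∧ i ≠ l ∧ j ≠ l := by
  simp [flagTriples]

theorem card_facePairs (l : Fin 4) : (facePairs l).card = 6 := by
  decide +revert

theorem card_flagTriples : flagTriples.card = 24 := by
  decide

theorem isFaceChain_fullFlag {l i j : Fin 4} (hil : i ≠ l) (hjl : j ≠ l) :
    IsFaceChain (fullFlag l i j) := by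
  have h1 : ({i} : Finset (Fin 4)) ⊆ {i, j} := by simp
  have h2 : ({i, j} : Finset (Fin 4)) ⊆ {l}ᶜ := by
    intro k hk
    rcases Finset.mem_insert.1 hk with rfl | hk
    · simpa using hil
    · rw [Finset.mem_singleton.1 hk]
      simpa using hjl
  have h3 := h1.trans h2
  constructor
  · intro s hs
    simp only [fullFlag, faceFlag, Finset.mem_insert, Finset.mem_singleton] at hs
    rcases hs with rfl | rfl | rfl | rfl
    · exact Finset.univ_nonempty
    · exact ⟨i, by simp⟩
    · exact ⟨i, by simp⟩
    · exact ⟨i, by simpa using hil⟩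
  · intro s hs t ht
    simp only [fullFlag, faceFlag, Finset.mem_insert, Finset.mem_singleton] at hs ht
    rcases hs with rfl | rfl | rfl | rfl <;> rcases ht with rfl | rfl | rfl | rfl <;>
      simp only [Finset.subset_univ, subset_refl, h1, h2, h3, true_or, or_true]

theorem faceFlag_subset_fullFlag (l i j : Fin 4) : faceFlag l i j ⊆ fullFlag l i j :=
  Finset.subset_insert _ _

theorem card_faceFlag {l i j : Fin 4} (hij : i ≠ j) : (faceFlag l i j).card = 3 := by
  have e2 := Finset.card_pair hij
  have e3 := card_compl_singleton_fin_four l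
  rw [faceFlag, Finset.card_insert_of_notMem, Finset.card_pair]
  · intro h
    rw [h, e3] at e2
    omega
  · simp only [Finset.mem_insert, Finset.mem_singleton, not_or]
    refine ⟨fun h => ?_, fun h => ?_⟩
    · rw [← h] at e2
      simp at e2
    · rw [← h] at e3
      simp at e3

theorem univ_notMem_faceFlag {l i j : Fin 4} (hij : i ≠ j) : Finset.univ ∉ faceFlag l i j := by
  intro h
  have e2 := Finset.card_pair hij
  have e3 := card_compl_singleton_fin_four l
  simp only [faceFlag, Finset.mem_insert, Finset.mem_singleton] at h
  rcases h with h | h | h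
  · have := congrArg Finset.card h
    simp at this
  · rw [← h] at e2
    simp at e2
  · rw [← h] at e3
    simp at e3

theorem card_fullFlag {l i j : Fin 4} (hij : i ≠ j) : (fullFlag l i j).card = 4 := by
  rw [fullFlag, Finset.card_insert_of_notMem (univ_notMem_faceFlag hij), card_faceFlag hij]

/-- A flag determines its members, as their cardinalities differ. -/
theorem faceFlag_inj {l i j l' i' j' : Fin 4} (hij : i ≠ j) (hij' : i' ≠ j')
    (h : faceFlag l i j = faceFlag l' i' j') : l = l' ∧ i = i' ∧ j = j' := by
  have e2 := Finset.card_pair hij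
  have e2' := Finset.card_pair hij'
  have e3 := card_compl_singleton_fin_four l
  have e3' := card_compl_singleton_fin_four l'
  have h1 : ({i} : Finset (Fin 4)) ∈ faceFlag l' i' j' := h ▸ by simp [faceFlag]
  have h2 : ({i, j} : Finset (Fin 4)) ∈ faceFlag l' i' j' := h ▸ by simp [faceFlag]
  have h3 : ({l}ᶜ : Finset (Fin 4)) ∈ faceFlag l' i' j' := h ▸ by simp [faceFlag]
  simp only [faceFlag, Finset.mem_insert, Finset.mem_singleton] at h1 h2 h3
  have f1 : ({i} : Finset (Fin 4)) = {i'} := by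
    rcases h1 with h1 | h1 | h1
    · exact h1
    · rw [← h1] at e2'
      simp at e2'
    · rw [← h1] at e3'
      simp at e3'
  have f2 : ({i, j} : Finset (Fin 4)) = {i', j'} := by
    rcases h2 with h2 | h2 | h2
    · rw [h2] at e2
      simp at e2
    · exact h2
    · rw [h2] at e2
      omega
  have f3 : ({l}ᶜ : Finset (Fin 4)) = {l'}ᶜ := by
    rcases h3 with h3 | h3 | h3
    · rw [h3] at e3
      simp at e3
    · rw [h3] at e3
      omega
    · exact h3
  have hi : i = i' := Finset.singleton_inj.1 f1
  refine ⟨Finset.singleton_inj.1 (compl_injective f3), hi, ?_⟩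
  have hj : j ∈ ({i', j'} : Finset (Fin 4)) := f2 ▸ by simp
  rcases Finset.mem_insert.1 hj with hj | hj
  · exact absurd (hi.trans hj.symm) hij
  · exact Finset.mem_singleton.1 hj

theorem fullFlag_inj {l i j l' i' j' : Fin 4} (hij : i ≠ j) (hij' : i' ≠ j')
    (h : fullFlag l i j = fullFlag l' i' j') : l = l' ∧ i = i' ∧ j = j' := by
  refine faceFlag_inj hij hij' ?_
  rw [← Finset.erase_insert (univ_notMem_faceFlag (l := l) hij),
    ← Finset.erase_insert (univ_notMem_faceFlag (l := l') hij')]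
  exact congrArg (fun D => D.erase Finset.univ) h

/-! ### The cells cover the tetrahedron and its faces -/

/-- A nonnegative vector that vanishes at `l` is a nonnegative combination of the weights of a flag
of the face opposite to `l`. -/
theorem IsFaceWeights.exists_faceFlag {b : Finset (Fin 4) → Fin 4 → ℝ} (hb : IsFaceWeights b)
    (l : Fin 4) {x : Fin 4 → ℝ} (hx : ∀ i, 0 ≤ x i) (hxl : x l = 0) :
    ∃ i j : Fin 4, i ≠ j ∧ i ≠ l ∧ j ≠ l ∧ ∃ c : Finset (Fin 4) → ℝ, (∀ s, 0 ≤ c s) ∧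
      (∀ s ∉ faceFlag l i j, c s = 0) ∧ ∀ k, ∑ s, c s * b s k = x k := by
  obtain ⟨t₁, ht₁, m, hm, hx₁, hz₁⟩ := hb.exists_sub_smul (s := {l}ᶜ)
    (Finset.card_pos.1 (by rw [card_compl_singleton_fin_four]; omega)) hx (fun i hi => by
      have : i = l := by simpa using hi
      rw [this, hxl])
  have hc2 : (({l}ᶜ : Finset (Fin 4)).erase m).card = 2 := by
    rw [Finset.card_erase_of_mem hm, card_compl_singleton_fin_four]
  obtain ⟨t₂, ht₂, j, hj, hx₂, hz₂⟩ := hb.exists_sub_smul (Finset.card_pos.1 (by omega)) hx₁ hz₁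
  have hc1 : ((({l}ᶜ : Finset (Fin 4)).erase m).erase j).card = 1 := by
    rw [Finset.card_erase_of_mem hj, hc2]
  obtain ⟨t₃, ht₃, i, hi, hx₃, hz₃⟩ := hb.exists_sub_smul (Finset.card_pos.1 (by omega)) hx₂ hz₂
  have e1 : (({l}ᶜ : Finset (Fin 4)).erase m).erase j = {i} := by
    obtain ⟨i', hi'⟩ := Finset.card_eq_one.1 hc1
    rw [hi', Finset.mem_singleton] at hi
    rw [hi', hi]
  have e2 : ({l}ᶜ : Finset (Fin 4)).erase m = {i, j} := by
    rw [← Finset.insert_erase hj, e1, Finset.pair_comm]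
  rw [e1] at hx₃ hz₃
  rw [e2] at hx₂ hz₂ hx₃ hz₃ hj
  have hij : i ≠ j := (Finset.mem_erase.1 hi).1
  have hil : i ≠ l := by
    have := (Finset.mem_erase.1 (Finset.mem_erase.1 hi).2).2
    simpa using this
  have hjl : j ≠ l := by
    have : j ∈ ({l}ᶜ : Finset (Fin 4)).erase m := e2 ▸ hj
    simpa using (Finset.mem_erase.1 this).2
  refine ⟨i, j, hij, hil, hjl, fun s => (if s = {l}ᶜ then t₁ else 0) + (if s = {i, j} then t₂ else 0)
    + (if s = {i} then t₃ else 0), fun s => ?_, fun s hs => ?_, fun k => ?_⟩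
  · positivity
  · simp only [faceFlag, Finset.mem_insert, Finset.mem_singleton, not_or] at hs
    simp [hs.1, hs.2.1, hs.2.2]
  · have := hz₃ k (by simp)
    simp only [add_mul, ite_mul, zero_mul, Finset.sum_add_distrib, Finset.sum_ite_eq',
      Finset.mem_univ, if_true]
    linarith

/-- A nonnegative vector is a nonnegative combination of the weights of a maximal flag. -/
theorem IsFaceWeights.exists_fullFlag {b : Finset (Fin 4) → Fin 4 → ℝ} (hb : IsFaceWeights b)
    {x : Fin 4 → ℝ} (hx : ∀ i, 0 ≤ x i) :
    ∃ l i j : Fin 4, i ≠ j ∧ i ≠ l ∧ j ≠ l ∧ ∃ c : Finset (Fin 4) → ℝ, (∀ s, 0 ≤ c s) ∧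
      (∀ s ∉ fullFlag l i j, c s = 0) ∧ ∀ k, ∑ s, c s * b s k = x k := by
  obtain ⟨t, ht, l, -, hx₁, hz₁⟩ :=
    hb.exists_sub_smul Finset.univ_nonempty hx (fun i hi => absurd (Finset.mem_univ i) hi)
  obtain ⟨i, j, hij, hil, hjl, c, hc0, hcD, hcx⟩ := hb.exists_faceFlag l hx₁ (hz₁ l (by simp))
  refine ⟨l, i, j, hij, hil, hjl, fun s => (if s = Finset.univ then t else 0) + c s, fun s => ?_,
    fun s hs => ?_, fun k => ?_⟩
  · have := hc0 s
    positivity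
  · simp only [fullFlag, Finset.mem_insert, not_or] at hs
    simp [hs.1, hcD s hs.2]
  · simp only [add_mul, ite_mul, zero_mul, Finset.sum_add_distrib, Finset.sum_ite_eq',
      Finset.mem_univ, if_true, hcx]
    ring

theorem mem_closedInterior_faceOpposite_iff (T : Affine.Simplex ℝ Space3 3) (l : Fin 4)
    {x : Space3} : x ∈ (T.faceOpposite l).closedInterior ↔
    ∃ w : Fin 4 → ℝ, (∀ i, 0 ≤ w i) ∧ w l = 0 ∧ ∑ i, w i = 1 ∧ ∑ i, w i • T.points i = x := by
  rw [mem_closedInterior_iff_exists_weights]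
  constructor
  · rintro ⟨w, hw0, hw1, hw⟩
    have hs : ∀ k : Fin 3, (l.insertNth (0 : ℝ) w : Fin 4 → ℝ) (l.succAbove k) = w k :=
      fun k => Fin.insertNth_apply_succAbove (α := fun _ => ℝ) l 0 w k
    have hl : (l.insertNth (0 : ℝ) w : Fin 4 → ℝ) l = 0 :=
      Fin.insertNth_apply_same (α := fun _ => ℝ) l 0 w
    refine ⟨(l.insertNth (0 : ℝ) w : Fin 4 → ℝ), fun k => ?_, hl, ?_, ?_⟩
    · rcases eq_or_ne k l with rfl | hk
      · exact hl.ge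
      · obtain ⟨m, rfl⟩ := Fin.exists_succAbove_eq hk
        rw [hs]
        exact hw0 m
    · rw [Fin.sum_univ_succAbove _ l, hl, zero_add, ← hw1]
      exact Finset.sum_congr rfl fun k _ => hs k
    · rw [Fin.sum_univ_succAbove _ l, hl, zero_smul, zero_add, ← hw]
      refine Finset.sum_congr rfl fun k _ => ?_
      rw [hs, faceOpposite_points]
  · rintro ⟨w, hw0, hl, hw1, hw⟩
    rw [Fin.sum_univ_succAbove _ l, hl, zero_add] at hw1
    rw [Fin.sum_univ_succAbove _ l, hl, zero_smul, zero_add] at hw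
    refine ⟨fun k => w (l.succAbove k), fun k => hw0 _, hw1, ?_⟩
    rw [← hw]
    exact Finset.sum_congr rfl fun k _ => by rw [faceOpposite_points]

theorem isFaceChain_faceFlag {l i j : Fin 4} (hil : i ≠ l) (hjl : j ≠ l) :
    IsFaceChain (faceFlag l i j) :=
  (isFaceChain_fullFlag hil hjl).mono (faceFlag_subset_fullFlag l i j)

open scoped Classical in
/-- The cells of the flags of a face cover this face. -/
theorem IsFaceWeights.mem_face_iff {T : Affine.Simplex ℝ Space3 3}
    {b : Finset (Fin 4) → Fin 4 → ℝ} (hb : IsFaceWeights b) (l : Fin 4) (x : Space3) :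
    x ∈ (T.faceOpposite l).closedInterior ↔
      ∃ D ∈ (fun p : Fin 4 × Fin 4 => faceFlag l p.1 p.2) '' facePairs l,
        x ∈ convexHull ℝ (D.image (facePoint T.points b) : Set Space3) := by
  rw [mem_closedInterior_faceOpposite_iff]
  constructor
  · rintro ⟨w, hw0, hl, hw1, hw⟩
    obtain ⟨i, j, hij, hil, hjl, c, hc0, hcD, hc⟩ := hb.exists_faceFlag l hw0 hl
    have hD := isFaceChain_faceFlag hil hjl
    refine ⟨faceFlag l i j, ⟨(i, j), mem_facePairs.2 ⟨hij, hil, hjl⟩, rfl⟩,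
      (hb.mem_convexHull_image_iff T.independent hD).2 ⟨c, hc0, hcD, ?_, ?_⟩⟩
    · rw [← hb.sum_sum hD hcD, ← hw1]
      exact Finset.sum_congr rfl fun k _ => hc k
    · rw [sum_smul_facePoint, ← hw]
      exact Finset.sum_congr rfl fun k _ => by rw [hc]
  · rintro ⟨_, ⟨⟨i, j⟩, hp, rfl⟩, hx⟩
    obtain ⟨hij, hil, hjl⟩ := mem_facePairs.1 (Finset.mem_coe.1 hp)
    have hD := isFaceChain_faceFlag hil hjl
    obtain ⟨c, hc0, hcD, hc1, hcx⟩ := (hb.mem_convexHull_image_iff T.independent hD).1 hx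
    refine ⟨fun k => ∑ s, c s * b s k,
      fun k => Finset.sum_nonneg fun s _ => mul_nonneg (hc0 s) (hb.nonneg s k), ?_, ?_, ?_⟩
    · refine Finset.sum_eq_zero fun s _ => ?_
      by_cases hs : s ∈ faceFlag l i j
      · rw [hb.zero s l, mul_zero]
        simp only [faceFlag, Finset.mem_insert, Finset.mem_singleton] at hs
        rcases hs with rfl | rfl | rfl
        · simpa using hil.symm
        · simpa using ⟨hil.symm, hjl.symm⟩
        · simp
      · rw [hcD s hs, zero_mul]
    · rw [hb.sum_sum hD hcD, hc1]
    · rw [← sum_smul_facePoint, hcx]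

open scoped Classical in
/-- The cells of the maximal flags cover the tetrahedron. -/
theorem IsFaceWeights.mem_tetrahedron_iff {T : Affine.Simplex ℝ Space3 3}
    {b : Finset (Fin 4) → Fin 4 → ℝ} (hb : IsFaceWeights b) (x : Space3) :
    x ∈ T.closedInterior ↔
      ∃ D ∈ (fun p : Fin 4 × Fin 4 × Fin 4 => fullFlag p.1 p.2.1 p.2.2) '' flagTriples,
        x ∈ convexHull ℝ (D.image (facePoint T.points b) : Set Space3) := by
  rw [mem_closedInterior_iff_exists_weights]
  constructor
  · rintro ⟨w, hw0, hw1, hw⟩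
    obtain ⟨l, i, j, hij, hil, hjl, c, hc0, hcD, hc⟩ := hb.exists_fullFlag hw0
    have hD := isFaceChain_fullFlag hil hjl
    refine ⟨fullFlag l i j, ⟨(l, i, j), mem_flagTriples.2 ⟨hij, hil, hjl⟩, rfl⟩,
      (hb.mem_convexHull_image_iff T.independent hD).2 ⟨c, hc0, hcD, ?_, ?_⟩⟩
    · rw [← hb.sum_sum hD hcD, ← hw1]
      exact Finset.sum_congr rfl fun k _ => hc k
    · rw [sum_smul_facePoint, ← hw]
      exact Finset.sum_congr rfl fun k _ => by rw [hc]
  · rintro ⟨_, ⟨⟨l, i, j⟩, hp, rfl⟩, hx⟩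
    obtain ⟨hij, hil, hjl⟩ := mem_flagTriples.1 (Finset.mem_coe.1 hp)
    have hD := isFaceChain_fullFlag hil hjl
    obtain ⟨c, hc0, hcD, hc1, hcx⟩ := (hb.mem_convexHull_image_iff T.independent hD).1 hx
    refine ⟨fun k => ∑ s, c s * b s k,
      fun k => Finset.sum_nonneg fun s _ => mul_nonneg (hc0 s) (hb.nonneg s k), ?_, ?_⟩
    · rw [hb.sum_sum hD hcD, hc1]
    · rw [← sum_smul_facePoint, hcx]

/-! ### Right angles -/

/-- The edge, the segment from its tangent point to the incenter of the face, and the segment from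
this incenter to the center of the mid-sphere are mutually orthogonal. -/
theorem IsMidSphere.orthogonal {T : Affine.Simplex ℝ Space3 3} {S : Sphere Space3}
    (hS : IsMidSphere T S) {l i j : Fin 4} (hil : i ≠ l) (hjl : j ≠ l) {p : Space3}
    (hp : TouchesSegmentAt S (T.points i) (T.points j) p) :
    inner ℝ (p - T.points i) ((T.faceOpposite l).incenter - p) = 0 ∧
      inner ℝ (p - T.points i) (S.center - (T.faceOpposite l).incenter) = 0 ∧
      inner ℝ ((T.faceOpposite l).incenter - p)
        (S.center - (T.faceOpposite l).incenter) = 0 := by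
  have hi := (T.points_mem_affineSpan_faceOpposite (i := l) (j := i)).2 hil
  have hj := (T.points_mem_affineSpan_faceOpposite (i := l) (j := j)).2 hjl
  have hpA := affineSpan_pair_le_of_mem_of_mem hi hj hp.2.mem_space
  have hF := (T.faceOpposite l).incenter_mem_affineSpan_range
  have h1 := hS.inner_incenter l hpA hi
  have h2 := hS.inner_incenter l hF hpA
  have h3 := hp.inner_left
  set F := (T.faceOpposite l).incenter
  set G := S.center
  have e1 : inner ℝ (p - T.points i) (G - F) = 0 := by
    rw [real_inner_comm, ← neg_sub F, inner_neg_left, h1, neg_zero]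
  have e2 : inner ℝ (F - p) (G - F) = 0 := by
    rw [real_inner_comm, ← neg_sub F, inner_neg_left, h2, neg_zero]
  have e3 : inner ℝ (p - T.points i) (p - G) = 0 := by
    rw [real_inner_comm, ← neg_sub (T.points i), inner_neg_right, h3, neg_zero]
  refine ⟨?_, e1, e2⟩
  have : F - p = -(p - G) - (G - F) := by abel
  rw [this, inner_sub_right, inner_neg_right, e1, e3, neg_zero, sub_zero]

theorem theorem7 (T : Affine.Simplex ℝ Space3 3) (S : Sphere Space3)
    (hS : IsMidSphere T S) (hcenter : S.center ∈ T.interior) :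
    ∃ K : Set (Finset Space3),
      IsFaceToFacePartition 3 K T.closedInterior ∧
      K.ncard = 24 ∧
      (∀ t ∈ K, IsPathTetrahedron t) ∧
      K = conedTetrahedra T S ∧
      ∀ l : Fin 4,
        IsFaceToFacePartition 2 (faceTriangles T S l) (T.faceOpposite l).closedInterior ∧
        (faceTriangles T S l).ncard = 6 ∧
        ∀ q ∈ faceTriangles T S l, IsRightTriangle q := by
  classical
  obtain ⟨b, hb, hQ1, hQ2, hQ3, hQ4⟩ := hS.exists_isFaceWeights hcenter
  have hv := T.independent
  set Q := facePoint T.points b with hQ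
  have hinj : ∀ D D' : Finset (Finset (Fin 4)), IsFaceChain D → IsFaceChain D' →
      D.image Q = D'.image Q → D = D' := by
    have hsub : ∀ D D' : Finset (Finset (Fin 4)), IsFaceChain D → IsFaceChain D' →
        D.image Q = D'.image Q → D ⊆ D' := by
      intro D D' hD hD' h s hs
      have hs' : Q s ∈ D'.image Q := h ▸ Finset.mem_image_of_mem Q hs
      obtain ⟨t, ht, hts⟩ := Finset.mem_image.1 hs'
      exact hb.facePoint_inj hv (hD'.1 t ht) (hD.1 s hs) hts ▸ ht
    exact fun D D' hD hD' h => (hsub D D' hD hD' h).antisymm (hsub D' D hD' hD h.symm)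
  have htri : ∀ l i j, (faceFlag l i j).image Q =
      {T.points i, Q {i, j}, (T.faceOpposite l).incenter} := by
    intro l i j
    simp only [faceFlag, Finset.image_insert, Finset.image_singleton, hQ1, hQ3]
  have htet : ∀ l i j, (fullFlag l i j).image Q = insert S.center ((faceFlag l i j).image Q) := by
    intro l i j
    rw [fullFlag, Finset.image_insert, hQ4]
  have hface : ∀ l, faceTriangles T S l = (fun D : Finset (Finset (Fin 4)) => D.image Q) ''
      ((fun p : Fin 4 × Fin 4 => faceFlag l p.1 p.2) '' facePairs l) := by
    intro l
    ext q
    constructor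
    · rintro ⟨i, j, hij, hil, hjl, p, hp, rfl⟩
      refine ⟨_, ⟨(i, j), mem_facePairs.2 ⟨hij, hil, hjl⟩, rfl⟩, (htri l i j).trans ?_⟩
      rw [hp.eq (hQ2 i j hij)]
    · rintro ⟨_, ⟨⟨i, j⟩, hp, rfl⟩, rfl⟩
      obtain ⟨hij, hil, hjl⟩ := mem_facePairs.1 (Finset.mem_coe.1 hp)
      exact ⟨i, j, hij, hil, hjl, _, hQ2 i j hij, htri l i j⟩
  have hcone : conedTetrahedra T S = (fun D : Finset (Finset (Fin 4)) => D.image Q) ''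
      ((fun p : Fin 4 × Fin 4 × Fin 4 => fullFlag p.1 p.2.1 p.2.2) '' flagTriples) := by
    ext t
    constructor
    · rintro ⟨l, q, hq, rfl⟩
      rw [hface] at hq
      obtain ⟨_, ⟨⟨i, j⟩, hp, rfl⟩, rfl⟩ := hq
      exact ⟨_, ⟨(l, i, j), mem_flagTriples.2 (mem_facePairs.1 (Finset.mem_coe.1 hp)), rfl⟩,
        htet l i j⟩
    · rintro ⟨_, ⟨⟨l, i, j⟩, hp, rfl⟩, rfl⟩
      refine ⟨l, (faceFlag l i j).image Q, ?_, htet l i j⟩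
      rw [hface]
      exact ⟨_, ⟨(i, j), mem_facePairs.2 (mem_flagTriples.1 (Finset.mem_coe.1 hp)), rfl⟩, rfl⟩
  have hFchain : ∀ l, ∀ D ∈ (fun p : Fin 4 × Fin 4 => faceFlag l p.1 p.2) '' facePairs l,
      IsFaceChain D ∧ D.card = 3 := by
    rintro l _ ⟨⟨i, j⟩, hp, rfl⟩
    have hp := mem_facePairs.1 (Finset.mem_coe.1 hp)
    exact ⟨isFaceChain_faceFlag hp.2.1 hp.2.2, card_faceFlag hp.1⟩
  have hTchain : ∀ D ∈
      (fun p : Fin 4 × Fin 4 × Fin 4 => fullFlag p.1 p.2.1 p.2.2) '' flagTriples,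
      IsFaceChain D ∧ D.card = 4 := by
    rintro _ ⟨⟨l, i, j⟩, hp, rfl⟩
    have hp := mem_flagTriples.1 (Finset.mem_coe.1 hp)
    exact ⟨isFaceChain_fullFlag hp.2.1 hp.2.2, card_fullFlag hp.1⟩
  refine ⟨conedTetrahedra T S, ?_, ?_, ?_, rfl, fun l => ⟨?_, ?_, ?_⟩⟩
  · rw [hcone]
    exact hb.isFaceToFacePartition hv (fun D hD => (hTchain D hD).1)
      (fun D hD => (hTchain D hD).2) hb.mem_tetrahedron_iff
  · rw [hcone, Set.InjOn.ncard_image, Set.InjOn.ncard_image, Set.ncard_coe_finset,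
      card_flagTriples]
    · rintro ⟨l, i, j⟩ hp ⟨l', i', j'⟩ hp' h
      have hp := mem_flagTriples.1 (Finset.mem_coe.1 hp)
      have hp' := mem_flagTriples.1 (Finset.mem_coe.1 hp')
      obtain ⟨rfl, rfl, rfl⟩ := fullFlag_inj hp.1 hp'.1 h
      rfl
    · exact fun D hD D' hD' h => hinj D D' (hTchain D hD).1 (hTchain D' hD').1 h
  · rw [hcone]
    rintro _ ⟨D, hDF, rfl⟩
    obtain ⟨hD, hcard⟩ := hTchain D hDF
    refine ⟨hb.isVertexSet hv hD hcard, ?_⟩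
    obtain ⟨⟨l, i, j⟩, hp, rfl⟩ := hDF
    obtain ⟨hij, hil, hjl⟩ := mem_flagTriples.1 (Finset.mem_coe.1 hp)
    have m1 : ({i} : Finset (Fin 4)) ∈ fullFlag l i j := by simp [fullFlag, faceFlag]
    have m2 : ({i, j} : Finset (Fin 4)) ∈ fullFlag l i j := by simp [fullFlag, faceFlag]
    have m3 : ({l}ᶜ : Finset (Fin 4)) ∈ fullFlag l i j := by simp [fullFlag, faceFlag]
    have m4 : (Finset.univ : Finset (Fin 4)) ∈ fullFlag l i j := by simp [fullFlag]
    have hne : ∀ s ∈ fullFlag l i j, ∀ t ∈ fullFlag l i j, s.card ≠ t.card → Q s ≠ Q t :=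
      fun s hs t ht hst h => hst (by rw [hb.facePoint_inj hv (hD.1 s hs) (hD.1 t ht) h])
    have k1 : ({i} : Finset (Fin 4)).card = 1 := Finset.card_singleton i
    have k2 : ({i, j} : Finset (Fin 4)).card = 2 := Finset.card_pair hij
    have k3 := card_compl_singleton_fin_four l
    have k4 : (Finset.univ : Finset (Fin 4)).card = 4 := by simp
    have horth := hS.orthogonal hil hjl (hQ2 i j hij)
    rw [← hQ1, ← hQ3, ← hQ4] at horth
    have hmem : ∀ s ∈ fullFlag l i j, Q s ∈ (fullFlag l i j).image Q :=
      fun s hs => Finset.mem_image_of_mem Q hs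
    refine ⟨Q {i}, Q {i, j}, Q {i, j}, Q {l}ᶜ, Q {l}ᶜ, Q Finset.univ,
      ⟨hmem _ m1, hmem _ m2, hne _ m1 _ m2 (by omega)⟩,
      ⟨hmem _ m2, hmem _ m3, hne _ m2 _ m3 (by omega)⟩,
      ⟨hmem _ m3, hmem _ m4, hne _ m3 _ m4 (by omega)⟩, horth.1, horth.2.1, horth.2.2, ?_⟩
    -- The first and the third edge are spanned by disjoint subflags.
    have hseg : ∀ s t : Finset (Fin 4),
        segment ℝ (Q s) (Q t) = convexHull ℝ (({s, t} : Finset (Finset (Fin 4))).image Q) := by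
      intro s t
      simp [convexHull_pair, Finset.image_insert, Finset.coe_insert]
    have hdisj : segment ℝ (Q {i}) (Q {i, j}) ∩ segment ℝ (Q {l}ᶜ) (Q Finset.univ) = ∅ := by
      rw [hseg, hseg, hb.convexHull_inter hv
        (hD.mono (by simp [Finset.insert_subset_iff, m1, m2]))
        (hD.mono (by simp [Finset.insert_subset_iff, m3, m4]))]
      have h0 : ({{i}, {i, j}} : Finset (Finset (Fin 4))) ∩ {{l}ᶜ, Finset.univ} = ∅ := by
        rw [← Finset.disjoint_iff_inter_eq_empty, Finset.disjoint_left]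
        intro s hs hs'
        simp only [Finset.mem_insert, Finset.mem_singleton] at hs hs'
        have h1 : s.card ≤ 2 := by rcases hs with rfl | rfl <;> omega
        have h2 : 3 ≤ s.card := by rcases hs' with rfl | rfl <;> omega
        omega
      rw [h0]
      simp
    refine Set.eq_empty_of_subset_empty ?_
    rintro x ⟨⟨hx1, -⟩, hx3⟩
    exact hdisj ▸ ⟨hx1, hx3⟩
  · rw [hface]
    exact hb.isFaceToFacePartition hv (fun D hD => (hFchain l D hD).1)
      (fun D hD => (hFchain l D hD).2) (hb.mem_face_iff l)
  · rw [hface, Set.InjOn.ncard_image, Set.InjOn.ncard_image, Set.ncard_coe_finset,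
      card_facePairs]
    · rintro ⟨i, j⟩ hp ⟨i', j'⟩ hp' h
      have hp := mem_facePairs.1 (Finset.mem_coe.1 hp)
      have hp' := mem_facePairs.1 (Finset.mem_coe.1 hp')
      obtain ⟨-, rfl, rfl⟩ := faceFlag_inj hp.1 hp'.1 h
      rfl
    · exact fun D hD D' hD' h => hinj D D' (hFchain l D hD).1 (hFchain l D' hD').1 h
  · rw [hface]
    rintro _ ⟨D, hDF, rfl⟩
    obtain ⟨hD, hcard⟩ := hFchain l D hDF
    refine ⟨hb.isVertexSet hv hD hcard, ?_⟩
    obtain ⟨⟨i, j⟩, hp, rfl⟩ := hDF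
    obtain ⟨hij, hil, hjl⟩ := mem_facePairs.1 (Finset.mem_coe.1 hp)
    have m1 : ({i} : Finset (Fin 4)) ∈ faceFlag l i j := by simp [faceFlag]
    have m2 : ({i, j} : Finset (Fin 4)) ∈ faceFlag l i j := by simp [faceFlag]
    have m3 : ({l}ᶜ : Finset (Fin 4)) ∈ faceFlag l i j := by simp [faceFlag]
    have hne : ∀ s ∈ faceFlag l i j, ∀ t ∈ faceFlag l i j, s.card ≠ t.card → Q s ≠ Q t :=
      fun s hs t ht hst h => hst (by rw [hb.facePoint_inj hv (hD.1 s hs) (hD.1 t ht) h])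
    have k1 : ({i} : Finset (Fin 4)).card = 1 := Finset.card_singleton i
    have k2 : ({i, j} : Finset (Fin 4)).card = 2 := Finset.card_pair hij
    have k3 := card_compl_singleton_fin_four l
    refine ⟨Q {i}, Finset.mem_image_of_mem Q m1, Q {i, j}, Finset.mem_image_of_mem Q m2,
      Q {l}ᶜ, Finset.mem_image_of_mem Q m3, ?_, hne _ m1 _ m2 (by omega), hne _ m3 _ m2 (by omega)⟩
    have horth := (hS.orthogonal hil hjl (hQ2 i j hij)).1
    rw [← hQ1, ← hQ3] at horth
    rw [EuclideanGeometry.angle, ← InnerProductGeometry.inner_eq_zero_iff_angle_eq_pi_div_two,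
      vsub_eq_sub, vsub_eq_sub, ← neg_sub, inner_neg_left, horth, neg_zero]
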